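/- Let $X_1,\dots,X_n$ be independent random variables with values in a measurable space $\mathcal X$, let $F:\mathcal X^n\to\mathbb R$ be measurable, and suppose that $Z=F(X_1,\dots,X_n)$ is integrable. Let $X_1',\dots,X_n'$ be independent copies of $X_1,\dots,X_n$ (that is, $X_1,\dots,X_n,X_1',\dots,X_n'$ are independent and $X_i'$ has the law of $X_i$), and put $$Z_i'=F(X_1,\dots,X_{i-1},X_i',X_{i+1},\dots,X_n).$$ With $x_+=\max(x,0)$ and $x_-=\max(-x,0)$, let $$V^{+}=\mathbb E\Big[\sum_{i=1}^n (Z-Z_i')_+^2\,\Big|\,X_1,\dots,X_n\Big],\qquad V^{-}=\mathbb E\Big[\sum_{i=1}^n (Z-Z_i')_-^2\,\Big|\,X_1,\dots,X_n\Big],$$ which are random variables with values in $[0,\infty]$. Write $\|Y\|_q=(\mathbb E|Y|^q)^{1/q}\in[0,\infty]$, and for real $q\ge 2$ let $$\kappa_q=\frac12\Big(1-\Big(1-\frac1q\Big)^{q/2}\Big)^{-1}.$$ Then for every real $q\ge 2$, $$\|(Z-\mathbb E Z)_+\|_q\le\sqrt{\Big(1-\frac1q\Big)2\kappa_q\,q\,\|V^+\|_{q/2}}\le\sqrt{2\kappa_q\,q\,\|V^+\|_{q/2}}=\sqrt{2\kappa_q\,q}\;\big\|\sqrt{V^+}\big\|_q$$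 and $$\|(Z-\mathbb E Z)_-\|_q\le\sqrt{\Big(1-\frac1q\Big)2\kappa_q\,q\,\|V^-\|_{q/2}}\le\sqrt{2\kappa_q\,q\,\|V^-\|_{q/2}}=\sqrt{2\kappa_q\,q}\;\big\|\sqrt{V^-}\big\|_q.$$ (The right-hand sides may be infinite, in which case the bounds are trivial.) -/

import Mathlib

open MeasureTheory ProbabilityTheory
open scoped ENNReal

namespace MomentIneq

/-- `Z = F (X₁, …, Xₙ)`. -/
def val {Ω 𝒳 : Type*} {n : ℕ} (F : (Fin n → 𝒳) → ℝ) (X : Fin n → Ω → 𝒳) (ω : Ω) : ℝ :=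
  F (fun j => X j ω)

/-- `Z'ᵢ = F (X₁, …, Xᵢ₋₁, X'ᵢ, Xᵢ₊₁, …, Xₙ)`. -/
def valCopy {Ω 𝒳 : Type*} {n : ℕ} (F : (Fin n → 𝒳) → ℝ) (X X' : Fin n → Ω → 𝒳) (i : Fin n)
    (ω : Ω) : ℝ :=
  F (Function.update (fun j => X j ω) i (X' i ω))

/-- The σ-algebra generated by the vector `(X₁, …, Xₙ)`. -/
abbrev sigmaX {Ω 𝒳 : Type*} [MeasurableSpace 𝒳] {n : ℕ} (X : Fin n → Ω → 𝒳) : MeasurableSpace Ω :=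
  MeasurableSpace.comap (fun ω j => X j ω) MeasurableSpace.pi

/-- `V⁺ = E[∑ᵢ (Z - Z'ᵢ)₊² | X₁, …, Xₙ]`, the conditional expectation of a nonnegative random
variable, with values in `[0, ∞]`. -/
noncomputable def Vplus {Ω 𝒳 : Type*} [MeasurableSpace Ω] [MeasurableSpace 𝒳] {n : ℕ}
    (μ : Measure Ω) (F : (Fin n → 𝒳) → ℝ) (X X' : Fin n → Ω → 𝒳) : Ω → ℝ≥0∞ :=
  condLExp (sigmaX X) μ fun ω =>
    ∑ i, ENNReal.ofReal ((max (val F X ω - valCopy F X X' i ω) 0) ^ 2)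

/-- `V⁻ = E[∑ᵢ (Z - Z'ᵢ)₋² | X₁, …, Xₙ]`, where `x₋ = max (-x) 0`. -/
noncomputable def Vminus {Ω 𝒳 : Type*} [MeasurableSpace Ω] [MeasurableSpace 𝒳] {n : ℕ}
    (μ : Measure Ω) (F : (Fin n → 𝒳) → ℝ) (X X' : Fin n → Ω → 𝒳) : Ω → ℝ≥0∞ :=
  condLExp (sigmaX X) μ fun ω =>
    ∑ i, ENNReal.ofReal ((max (-(val F X ω - valCopy F X X' i ω)) 0) ^ 2)

/-- `κ_q = (1/2) (1 - (1 - 1/q)^(q/2))⁻¹`, used for real `q ≥ 2`. -/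
noncomputable def kappa (q : ℝ) : ℝ :=
  1 / 2 * (1 - (1 - 1 / q) ^ (q / 2))⁻¹

end MomentIneq

namespace MomentIneq

/-! The core is a modified entropy inequality for the power `1 + r`, where `0 < r ≤ 1`. In one
variable, Jensen for the concave `t ^ r` bounds `E f ^ (1 + r) - (E f) ^ (1 + r)` by half the mean
of `gap r` over two independent copies. Since `gap r` is jointly convex on the quadrant
(`convexOn_gap`), averaging over the other coordinates can be pulled outside it, and induction on
the number of variables gives `lintegral_rpow_pi_le`. By exchangeability only the positive half
`gapPos` is needed.

Take `r = 1 / (q - 1)` and `f = H ^ (q - 1)` with `H = (Z - E Z)₊`. Then `gapPos` is at most `(q -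
1) (Z - Z'ᵢ)₊ ^ 2 H ^ (q - 2)`, and conditioning followed by Hölder yields, with `N s = ‖H‖_s` and
`v = ‖V⁺‖_{q/2}`, `N s ^ s ≤ N (s - 1) ^ s + (s - 1) v N s ^ (s - 2)` for `2 ≤ s ≤ q`. This
recursion is solved in `moment_recursion`; it starts on `[1, 2]` from Efron–Stein, which is the case
`q = 2` of the same inequality. All this is done for bounded functions; truncation and Fatou remove
the bound. -/

/-! ### Joint convexity of `(a - b) (a ^ r - b ^ r)`. -/

lemma sq_div_convex {u u' v v' : ℝ} (hv : 0 < v) (hv' : 0 < v') {a b : ℝ} (ha : 0 ≤ a)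
    (hb : 0 ≤ b) (hab : a + b = 1) :
    (a * u + b * u') ^ 2 / (a * v + b * v') ≤ a * (u ^ 2 / v) + b * (u' ^ 2 / v') := by
  have h : 0 < a * v + b * v' := by
    rcases eq_or_lt_of_le ha with rfl | ha
    · have : b = 1 := by linarith
      subst this; simpa
    · positivity
  rw [div_le_iff₀ h]
  -- The convexity defect, once denominators are cleared, is an explicit square.
  have e : (a * (u ^ 2 / v) + b * (u' ^ 2 / v')) * (a * v + b * v') - (a * u + b * u') ^ 2
      = a * b * (u * v' - u' * v) ^ 2 / (v * v') := by
    field_simp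
    ring
  have : 0 ≤ a * b * (u * v' - u' * v) ^ 2 / (v * v') := by positivity
  linarith

/-- Since `w ^ (1 - r)` is concave, replacing the denominator of `u ^ 2 / w ^ (1 - r)` at the mixed
point by the mixture of denominators only increases the quotient; then `sq_div_convex` applies. -/
lemma sq_mul_rpow_convex {r : ℝ} (hr0 : 0 < r) (hr1 : r ≤ 1) {u u' w w' : ℝ} (hw : 0 < w)
    (hw' : 0 < w') {a b : ℝ} (ha : 0 ≤ a) (hb : 0 ≤ b) (hab : a + b = 1) :
    (a * u + b * u') ^ 2 * (a * w + b * w') ^ (r - 1)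
      ≤ a * (u ^ 2 * w ^ (r - 1)) + b * (u' ^ 2 * w' ^ (r - 1)) := by
  have h : 0 < a * w + b * w' := by
    rcases eq_or_lt_of_le ha with rfl | ha
    · have : b = 1 := by linarith
      subst this; simpa
    · positivity
  have conc := (Real.concaveOn_rpow (p := 1 - r) (by linarith) (by linarith)).2
    (show w ∈ Set.Ici (0 : ℝ) from hw.le) (show w' ∈ Set.Ici (0 : ℝ) from hw'.le) ha hb hab
  simp only [smul_eq_mul] at conc
  have e : ∀ t : ℝ, 0 < t → t ^ (r - 1) = (t ^ (1 - r))⁻¹ := fun t ht => by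
    rw [← Real.rpow_neg ht.le]; congr 1; ring
  rw [e _ h, e _ hw, e _ hw', ← div_eq_mul_inv, ← div_eq_mul_inv, ← div_eq_mul_inv]
  have p1 : 0 < w ^ (1 - r) := by positivity
  have p2 : 0 < w' ^ (1 - r) := by positivity
  have p3 : 0 < a * w ^ (1 - r) + b * w' ^ (1 - r) := by
    rcases eq_or_lt_of_le ha with rfl | ha
    · have : b = 1 := by linarith
      subst this; simpa
    · positivity
  exact (div_le_div_of_nonneg_left (sq_nonneg _) p3 conc).trans (sq_div_convex p1 p2 ha hb hab)

/-- The function `(a, b) ↦ (a - b) (a ^ r - b ^ r)`. -/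
noncomputable def gap (r : ℝ) (p : ℝ × ℝ) : ℝ := (p.1 - p.2) * (p.1 ^ r - p.2 ^ r)

lemma continuous_gap {r : ℝ} (hr0 : 0 ≤ r) : Continuous (gap r) := by
  unfold gap
  exact (continuous_fst.sub continuous_snd).mul
    ((continuous_fst.rpow_const fun _ => Or.inr hr0).sub
      (continuous_snd.rpow_const fun _ => Or.inr hr0))

/-- Integrating the derivative of `t ^ r` along the segment from `b` to `a` exhibits `gap` as a
superposition of functions covered by `sq_mul_rpow_convex`, the segment point being linear in `(a,
b)`. -/
lemma gap_eq_integral {r a b : ℝ} (hr0 : 0 < r) :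
    gap r (a, b) = r * ∫ s in (0 : ℝ)..1, (a - b) ^ 2 * (b + (a - b) * s) ^ (r - 1) := by
  have h1 := intervalIntegral.mul_integral_comp_add_mul (a := (0 : ℝ)) (b := 1)
    (f := fun t : ℝ => t ^ (r - 1)) (a - b) b
  have h2 : ∫ t in b..a, t ^ (r - 1) = (a ^ r - b ^ r) / r := by
    rw [integral_rpow (Or.inl (by linarith))]; simp
  simp only [mul_zero, add_zero, mul_one, add_sub_cancel] at h1
  rw [h2] at h1
  rw [intervalIntegral.integral_const_mul, pow_two, mul_assoc, h1, gap]
  field_simp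

lemma segment_pos {a b s : ℝ} (ha : 0 < a) (hb : 0 < b) (h0 : 0 ≤ s) (h1 : s ≤ 1) :
    0 < b + (a - b) * s := by
  rcases eq_or_lt_of_le h0 with rfl | h0
  · simpa
  · nlinarith [mul_pos ha h0, mul_nonneg hb.le (sub_nonneg.2 h1)]

lemma intervalIntegrable_gap {r a b : ℝ} (ha : 0 < a) (hb : 0 < b) :
    IntervalIntegrable (fun s : ℝ => (a - b) ^ 2 * (b + (a - b) * s) ^ (r - 1)) volume 0 1 := by
  apply ContinuousOn.intervalIntegrable
  rw [Set.uIcc_of_le zero_le_one]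
  refine continuousOn_const.mul (ContinuousOn.rpow_const (by fun_prop) fun s hs => Or.inl ?_)
  exact (segment_pos ha hb hs.1 hs.2).ne'

lemma gap_convex_of_pos {r : ℝ} (hr0 : 0 < r) (hr1 : r ≤ 1) {p p' : ℝ × ℝ} (h1 : 0 < p.1)
    (h2 : 0 < p.2) (h1' : 0 < p'.1) (h2' : 0 < p'.2) {a b : ℝ} (ha : 0 ≤ a) (hb : 0 ≤ b)
    (hab : a + b = 1) : gap r (a • p + b • p') ≤ a * gap r p + b * gap r p' := by
  have pos : ∀ {x y : ℝ}, 0 < x → 0 < y → 0 < a * x + b * y := fun {x y} hx hy => by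
    rcases eq_or_lt_of_le ha with rfl | ha
    · have : b = 1 := by linarith
      subst this; simpa
    · positivity
  obtain ⟨p1, p2⟩ := p
  obtain ⟨p1', p2'⟩ := p'
  simp only [Prod.smul_mk, Prod.mk_add_mk, smul_eq_mul] at *
  rw [gap_eq_integral hr0, gap_eq_integral hr0,
    gap_eq_integral hr0, mul_left_comm a, mul_left_comm b, ← mul_add,
    ← intervalIntegral.integral_const_mul a, ← intervalIntegral.integral_const_mul b,
    ← intervalIntegral.integral_add ((intervalIntegrable_gap h1 h2).const_mul _)
      ((intervalIntegrable_gap h1' h2').const_mul _)]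
  refine mul_le_mul_of_nonneg_left (intervalIntegral.integral_mono_on zero_le_one
    (intervalIntegrable_gap (pos h1 h1') (pos h2 h2'))
    (((intervalIntegrable_gap h1 h2).const_mul _).add
      ((intervalIntegrable_gap h1' h2').const_mul _)) fun s hs => ?_) hr0.le
  convert sq_mul_rpow_convex hr0 hr1 (u := p1 - p2) (u' := p1' - p2')
    (segment_pos h1 h2 hs.1 hs.2) (segment_pos h1' h2' hs.1 hs.2) ha hb hab using 3 <;> ring

lemma convexOn_gap {r : ℝ} (hr0 : 0 < r) (hr1 : r ≤ 1) :
    ConvexOn ℝ (Set.Ici (0 : ℝ × ℝ)) (gap r) := by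
  refine ⟨convex_Ici _, fun p hp p' hp' a b ha hb hab => ?_⟩
  -- The integral argument needs positive coordinates because `r - 1 ≤ 0`. A diagonal shift moves
  -- the closed quadrant into the open one, and continuity lets the shift tend to zero.
  let e : ℝ → ℝ × ℝ := fun t => (t, t)
  have he : Continuous e := by fun_prop
  have cg := continuous_gap hr0.le
  have key : ∀ᶠ t in nhdsWithin (0 : ℝ) (Set.Ioi 0),
      gap r (a • (p + e t) + b • (p' + e t)) ≤ a * gap r (p + e t) + b * gap r (p' + e t) := by
    filter_upwards [self_mem_nhdsWithin] with t ht
    have ht : (0 : ℝ) < t := ht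
    have h1 := hp.1; have h2 := hp.2; have h3 := hp'.1; have h4 := hp'.2
    simp only [Prod.fst_zero, Prod.snd_zero] at h1 h2 h3 h4
    exact gap_convex_of_pos hr0 hr1 (by simp [e]; linarith) (by simp [e]; linarith)
      (by simp [e]; linarith) (by simp [e]; linarith) ha hb hab
  have c1 : Continuous fun t => gap r (a • (p + e t) + b • (p' + e t)) := by fun_prop
  have c2 : Continuous fun t => a * gap r (p + e t) + b * gap r (p' + e t) := by fun_prop
  have := le_of_tendsto_of_tendsto ((c1.tendsto 0).mono_left nhdsWithin_le_nhds)
    ((c2.tendsto 0).mono_left nhdsWithin_le_nhds) key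
  have e0 : e 0 = 0 := rfl
  simpa [e0] using this

/-! ### The constant `κ_q` and the solution of the moment recursion. -/

lemma one_sub_inv_rpow_mono {p q : ℝ} (hp : 1 < p) (hpq : p ≤ q) :
    (1 - 1 / p) ^ (p / 2) ≤ (1 - 1 / q) ^ (q / 2) := by
  have hp0 : 0 < p := by linarith
  have hq0 : 0 < q := by linarith
  have hp1 : 1 / p < 1 := by rw [div_lt_one hp0]; exact hp
  -- Bernoulli with exponent `p / q ≤ 1` gives `(1 - 1 / p) ^ (p / q) ≤ 1 - 1 / q`; the power `q /
  -- 2` of this is the claim.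
  have h := rpow_one_add_le_one_add_mul_self (s := -(1 / p)) (p := p / q) (by linarith)
    (by positivity) (by rw [div_le_one hq0]; exact hpq)
  have e : 1 + p / q * -(1 / p) = 1 - 1 / q := by field_simp; ring
  rw [e, ← sub_eq_add_neg] at h
  have h0 : 0 ≤ 1 - 1 / p := by linarith
  have := Real.rpow_le_rpow (by positivity) h (z := q / 2) (by positivity)
  rw [← Real.rpow_mul h0] at this
  convert this using 2
  field_simp

lemma one_sub_inv_rpow_two : (1 - 1 / (2 : ℝ)) ^ ((2 : ℝ) / 2) = 1 / 2 := by norm_num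

lemma one_sub_inv_rpow_ge {q : ℝ} (hq : 2 ≤ q) : 1 / 2 ≤ (1 - 1 / q) ^ (q / 2) := by
  rw [← one_sub_inv_rpow_two]
  exact one_sub_inv_rpow_mono one_lt_two hq

lemma one_sub_inv_rpow_lt {q : ℝ} (hq : 2 ≤ q) : (1 - 1 / q) ^ (q / 2) < 1 := by
  have : 1 / q < 1 := by rw [div_lt_one (by linarith)]; linarith
  have : 0 < 1 / q := by positivity
  exact Real.rpow_lt_one (by linarith) (by linarith) (by linarith)

lemma two_kappa {q : ℝ} : 2 * kappa q = (1 - (1 - 1 / q) ^ (q / 2))⁻¹ := by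
  unfold kappa; ring

lemma two_le_two_kappa {q : ℝ} (hq : 2 ≤ q) : 2 ≤ 2 * kappa q := by
  rw [two_kappa, le_inv_comm₀ two_pos (by linarith [one_sub_inv_rpow_lt hq])]
  linarith [one_sub_inv_rpow_ge hq]

lemma two_kappa_mono {p q : ℝ} (hp : 2 ≤ p) (hpq : p ≤ q) : 2 * kappa p ≤ 2 * kappa q := by
  rw [two_kappa, two_kappa]
  have := one_sub_inv_rpow_lt (hp.trans hpq)
  have := one_sub_inv_rpow_mono (by linarith) hpq
  exact inv_anti₀ (by linarith) (by linarith)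

/-- One step of the moment recursion. -/
lemma sq_le_of_moment_step {s v x y : ℝ} (hs : 2 ≤ s) (hv : 0 ≤ v) (hx : 0 ≤ x) (hy : 0 ≤ y)
    (h : x ^ s ≤ y ^ s + (s - 1) * v * x ^ (s - 2))
    (hxy : y ^ 2 * s ≤ (s - 1) ^ 2 * (2 * kappa s) * v) :
    x ^ 2 ≤ (s - 1) * (2 * kappa s) * v := by
  -- With `ρ = (1 - 1 / s) ^ (s / 2)`, the constant `K = 2 κ_s` is exactly `1 / (1 - ρ)`. If the
  -- bound fails, the last term of `h` is below `(1 - ρ) x ^ s`, so `ρ x ^ s < y ^ s`. Taking the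
  -- power `2 / s` gives `(1 - 1 / s) x ^ 2 < y ^ 2`, and `hxy` then contradicts the assumption.
  by_contra! hlt
  set K := 2 * kappa s with hK
  have hK2 : 2 ≤ K := two_le_two_kappa hs
  set ρ := (1 - 1 / s) ^ (s / 2) with hρ
  have hρK : (1 - ρ) * K = 1 := by
    rw [hK, two_kappa, ← hρ]
    exact mul_inv_cancel₀ (by linarith [one_sub_inv_rpow_lt hs])
  have hx0 : 0 < x := by
    rcases eq_or_lt_of_le hx with rfl | h
    · have : 0 ≤ (s - 1) * K * v := by
        have : 0 ≤ s - 1 := by linarith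
        positivity
      simp at hlt; linarith
    · exact h
  have h1 : x ^ s = x ^ (s - 2) * x ^ 2 := by
    rw [← Real.rpow_natCast x 2, ← Real.rpow_add hx0]; norm_num
  have h2 : (s - 1) * v < x ^ 2 * (1 - ρ) := by
    have : 0 < 1 - ρ := by linarith [one_sub_inv_rpow_lt hs]
    calc (s - 1) * v = ((s - 1) * K * v) * (1 - ρ) := by
          rw [show (s - 1) * K * v * (1 - ρ) = (s - 1) * v * ((1 - ρ) * K) by ring, hρK, mul_one]
      _ < _ := mul_lt_mul_of_pos_right hlt this
  have h3 : x ^ s * ρ < y ^ s := by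
    have : 0 < x ^ (s - 2) := by positivity
    have := mul_lt_mul_of_pos_left h2 this
    rw [h1] at h ⊢
    linarith
  have hs1 : 0 < 1 - 1 / s := by
    have : 1 / s < 1 := by rw [div_lt_one (by linarith)]; linarith
    linarith
  have h4 : (x ^ 2 * (1 - 1 / s)) ^ (s / 2) < (y ^ 2) ^ (s / 2) := by
    rw [Real.mul_rpow (by positivity) hs1.le, ← Real.rpow_natCast x 2, ← Real.rpow_natCast y 2,
      ← Real.rpow_mul hx, ← Real.rpow_mul hy]
    convert h3 using 2 <;> · push_cast; congr 1; ring
  have h5 : x ^ 2 * (1 - 1 / s) < y ^ 2 :=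
    (Real.rpow_lt_rpow_iff (by positivity) (by positivity) (by positivity)).1 h4
  have h6 : x ^ 2 * (s - 1) < y ^ 2 * s := by
    have : 0 < s := by linarith
    have := mul_lt_mul_of_pos_right h5 this
    rwa [show x ^ 2 * (1 - 1 / s) * s = x ^ 2 * (s - 1) by field_simp] at this
  nlinarith

lemma moment_recursion {N : ℝ → ℝ} {v q : ℝ} (hv : 0 ≤ v) (hN : ∀ s, 0 ≤ N s)
    (h2 : ∀ s, 1 ≤ s → s ≤ 2 → N s ^ 2 ≤ v)
    (h : ∀ s, 2 ≤ s → s ≤ q → N s ^ s ≤ N (s - 1) ^ s + (s - 1) * v * N s ^ (s - 2))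
    (hq : 2 ≤ q) : N q ^ 2 ≤ (q - 1) * (2 * kappa q) * v := by
  -- The exponent is real and drops by one, so the induction runs over ranges growing by unit
  -- length. The base range `[2, 3]` is the one whose predecessors lie in `[1, 2]`.
  have key : ∀ k : ℕ, ∀ s, 2 ≤ s → s ≤ q → s ≤ k + 3 →
      N s ^ 2 ≤ (s - 1) * (2 * kappa s) * v := by
    intro k
    induction k with
    | zero =>
      intro s hs hsq hsk
      refine sq_le_of_moment_step hs hv (hN _) (hN _) (h s hs hsq) ?_
      have := two_le_two_kappa hs
      have h1 := h2 (s - 1) (by linarith) (by norm_num at hsk; linarith)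
      calc N (s - 1) ^ 2 * s ≤ v * s := by gcongr
        -- Uses `s ≤ 2 (s - 1) ^ 2`, an equality at `s = 2`.
        _ ≤ v * ((s - 1) ^ 2 * 2) := by gcongr; nlinarith
        _ ≤ v * ((s - 1) ^ 2 * (2 * kappa s)) := by gcongr
        _ = _ := by ring
    | succ k ih =>
      intro s hs hsq hsk
      rcases le_or_gt s (k + 3) with h' | h'
      · exact ih s hs hsq h'
      have hk : (0 : ℝ) ≤ k := by positivity
      refine sq_le_of_moment_step hs hv (hN _) (hN _) (h s hs hsq) ?_
      have h1 := ih (s - 1) (by linarith) (by linarith) (by push_cast at hsk; linarith)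
      have := two_le_two_kappa hs
      calc N (s - 1) ^ 2 * s ≤ ((s - 1 - 1) * (2 * kappa (s - 1)) * v) * s := by gcongr
        _ ≤ ((s - 1 - 1) * (2 * kappa s) * v) * s := by
          have : 0 ≤ s - 1 - 1 := by linarith
          have := two_kappa_mono (p := s - 1) (q := s) (by linarith) (by linarith)
          gcongr
        _ = ((s - 1 - 1) * s) * ((2 * kappa s) * v) := by ring
        -- The induction closes because `(s - 2) s ≤ (s - 1) ^ 2`.
        _ ≤ (s - 1) ^ 2 * ((2 * kappa s) * v) := by
          have : 0 ≤ 2 * kappa s * v := mul_nonneg (by linarith) hv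
          gcongr; nlinarith
        _ = _ := by ring
  obtain ⟨k, hk⟩ := exists_nat_ge q
  exact key k q hq le_rfl (by linarith)

/-- `a ^ α - b ^ α ≤ α a ^ (α - 1) (a - b)` for `a ≥ b ≥ 0`. -/
lemma rpow_sub_rpow_le {α a b : ℝ} (hα : 1 ≤ α) (hb : 0 ≤ b) (hab : b ≤ a) :
    a ^ α - b ^ α ≤ α * a ^ (α - 1) * (a - b) := by
  rcases eq_or_lt_of_le (hb.trans hab) with h | ha
  · have : b = a := le_antisymm hab (h ▸ hb)
    simp [this]
  have h := one_add_mul_self_le_rpow_one_add (s := b / a - 1) (p := α)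
    (by have : 0 ≤ b / a := by positivity
        linarith) hα
  rw [add_sub_cancel, Real.div_rpow hb ha.le, le_div_iff₀ (by positivity)] at h
  have e : a ^ α = a ^ (α - 1) * a := by
    rw [← Real.rpow_add_one ha.ne']; congr 1; ring
  have : (1 + α * (b / a - 1)) * a ^ α = a ^ α - α * a ^ (α - 1) * (a - b) := by
    rw [e]; field_simp; ring
  linarith

/-! ### Tensorization over product measures. -/

section Tensorization

variable {α β 𝒳 : Type*} [MeasurableSpace α] [MeasurableSpace β] [MeasurableSpace 𝒳]

lemma integrable_of_mem_Icc {μ : Measure α} [IsFiniteMeasure μ] {f : α → ℝ} (hf : Measurable f)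
    {a b : ℝ} (h : ∀ x, f x ∈ Set.Icc a b) : Integrable f μ :=
  Integrable.of_mem_Icc a b hf.aemeasurable (Filter.Eventually.of_forall h)

lemma integral_mem_Icc {μ : Measure α} [IsProbabilityMeasure μ] {f : α → ℝ} (hf : Measurable f)
    {a b : ℝ} (h : ∀ x, f x ∈ Set.Icc a b) : ∫ x, f x ∂μ ∈ Set.Icc a b :=
  (convex_Icc a b).integral_mem isClosed_Icc (Filter.Eventually.of_forall h)
    (integrable_of_mem_Icc hf h)

lemma rpow_mem_Icc {C t s : ℝ} (hs : 0 ≤ s) (ht : t ∈ Set.Icc 0 C) :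
    t ^ s ∈ Set.Icc 0 (C ^ s) :=
  ⟨Real.rpow_nonneg ht.1 _, Real.rpow_le_rpow ht.1 ht.2 hs⟩

/-- `(a - b)₊ (a ^ r - b ^ r)₊`. -/
noncomputable def gapPos (r a b : ℝ) : ℝ := max (a - b) 0 * max (a ^ r - b ^ r) 0

lemma gapPos_nonneg (r a b : ℝ) : 0 ≤ gapPos r a b := by
  unfold gapPos; positivity

lemma gap_eq_add {r a b : ℝ} (hr : 0 < r) (ha : 0 ≤ a) (hb : 0 ≤ b) :
    gap r (a, b) = gapPos r a b + gapPos r b a := by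
  unfold gap gapPos
  rcases le_total a b with h | h
  · have := Real.rpow_le_rpow ha h hr.le
    rw [max_eq_right (by linarith : a - b ≤ 0), max_eq_left (by linarith : 0 ≤ b - a),
      max_eq_left (by linarith : 0 ≤ b ^ r - a ^ r)]
    ring
  · have := Real.rpow_le_rpow hb h hr.le
    rw [max_eq_right (by linarith : b - a ≤ 0), max_eq_left (by linarith : 0 ≤ a - b),
      max_eq_left (by linarith : 0 ≤ a ^ r - b ^ r)]
    ring

lemma gap_nonneg {r a b : ℝ} (hr : 0 < r) (ha : 0 ≤ a) (hb : 0 ≤ b) : 0 ≤ gap r (a, b) := by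
  rw [gap_eq_add hr ha hb]
  exact add_nonneg (gapPos_nonneg _ _ _) (gapPos_nonneg _ _ _)

lemma gap_eq_expand {r a b : ℝ} (hr : 0 < r) (ha : 0 ≤ a) (hb : 0 ≤ b) :
    gap r (a, b) = a ^ (1 + r) + b ^ (1 + r) - a * b ^ r - a ^ r * b := by
  rw [Real.rpow_one_add' ha (by linarith), Real.rpow_one_add' hb (by linarith), gap]
  ring

@[fun_prop]
lemma measurable_gap (r : ℝ) : Measurable (gap r) := by
  unfold gap; fun_prop

@[fun_prop]
lemma measurable_gapPos {r : ℝ} {f g : α → ℝ} (hf : Measurable f) (hg : Measurable g) :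
    Measurable fun x => gapPos r (f x) (g x) := by
  unfold gapPos; fun_prop

lemma gap_mem_Icc {r C a b : ℝ} (hr : 0 < r) (ha : a ∈ Set.Icc 0 C) (hb : b ∈ Set.Icc 0 C) :
    gap r (a, b) ∈ Set.Icc 0 (C ^ (1 + r) + C ^ (1 + r)) := by
  refine ⟨gap_nonneg hr ha.1 hb.1, ?_⟩
  rw [gap_eq_expand hr ha.1 hb.1]
  have h1 := (rpow_mem_Icc (s := 1 + r) (by linarith) ha).2
  have h2 := (rpow_mem_Icc (s := 1 + r) (by linarith) hb).2
  have h3 : 0 ≤ a * b ^ r := mul_nonneg ha.1 (Real.rpow_nonneg hb.1 _)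
  have h4 : 0 ≤ a ^ r * b := mul_nonneg (Real.rpow_nonneg ha.1 _) hb.1
  linarith

lemma gap_integral_le {r : ℝ} (hr0 : 0 < r) (hr1 : r ≤ 1) {π : Measure β}
    [IsProbabilityMeasure π] {f g : β → ℝ} (hf : Measurable f) (hg : Measurable g) {C : ℝ}
    (hfC : ∀ x, f x ∈ Set.Icc 0 C) (hgC : ∀ x, g x ∈ Set.Icc 0 C) :
    gap r (∫ x, f x ∂π, ∫ x, g x ∂π) ≤ ∫ x, gap r (f x, g x) ∂π := by
  have If := integrable_of_mem_Icc (μ := π) hf hfC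
  have Ig := integrable_of_mem_Icc (μ := π) hg hgC
  rw [← integral_pair If Ig]
  refine (convexOn_gap hr0 hr1).map_integral_le (continuous_gap hr0.le).continuousOn isClosed_Ici
    (Filter.Eventually.of_forall fun x => ?_) (If.prodMk Ig) ?_
  · exact ⟨(hfC x).1, (hgC x).1⟩
  · exact integrable_of_mem_Icc (by simp only [Function.comp_def]; fun_prop)
      fun x => gap_mem_Icc hr0 (hfC x) (hgC x)

/-- Expanding the product, the double integral of `gap` equals `2 E f ^ (1 + r) - 2 (E f) (E f ^
r)`, and Jensen gives `E f ^ r ≤ (E f) ^ r`. -/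
lemma integral_rpow_le_add_gap {r : ℝ} (hr0 : 0 < r) (hr1 : r ≤ 1) {ν : Measure α}
    [IsProbabilityMeasure ν] {f : α → ℝ} (hf : Measurable f) {C : ℝ}
    (hfC : ∀ x, f x ∈ Set.Icc 0 C) :
    2 * ∫ y, f y ^ (1 + r) ∂ν
      ≤ 2 * (∫ y, f y ∂ν) ^ (1 + r) + ∫ y, ∫ y', gap r (f y, f y') ∂ν ∂ν := by
  have I1 := integrable_of_mem_Icc (μ := ν) hf hfC
  have I2 : Integrable (fun y => f y ^ r) ν :=
    integrable_of_mem_Icc (by fun_prop) fun x => rpow_mem_Icc hr0.le (hfC x)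
  have I3 : Integrable (fun y => f y ^ (1 + r)) ν :=
    integrable_of_mem_Icc (by fun_prop) fun x => rpow_mem_Icc (by linarith) (hfC x)
  have jensen : ∫ y, f y ^ r ∂ν ≤ (∫ y, f y ∂ν) ^ r :=
    (Real.concaveOn_rpow hr0.le hr1).le_map_integral
      (Real.continuous_rpow_const hr0.le).continuousOn isClosed_Ici
      (Filter.Eventually.of_forall fun x => (hfC x).1) I1 I2
  have inner : ∀ y, ∫ y', gap r (f y, f y') ∂ν
      = f y ^ (1 + r) + ∫ y', f y' ^ (1 + r) ∂ν - f y * ∫ y', f y' ^ r ∂ν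
        - f y ^ r * ∫ y', f y' ∂ν := fun y => by
    simp_rw [fun y' => gap_eq_expand hr0 (hfC y).1 (hfC y').1]
    have J1 : Integrable (fun y' => f y ^ (1 + r) + f y' ^ (1 + r)) ν :=
      (integrable_const _).add I3
    have J2 : Integrable (fun y' => f y ^ (1 + r) + f y' ^ (1 + r) - f y * f y' ^ r) ν :=
      J1.sub (I2.const_mul _)
    rw [integral_sub J2 (I1.const_mul _), integral_sub J1 (I2.const_mul _),
      integral_add (integrable_const _) I3, integral_const_mul, integral_const_mul]
    simp
  simp_rw [inner]
  have J1 : Integrable (fun y => f y ^ (1 + r) + ∫ y', f y' ^ (1 + r) ∂ν) ν :=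
    I3.add (integrable_const _)
  have J2 : Integrable (fun y => f y ^ (1 + r) + ∫ y', f y' ^ (1 + r) ∂ν
      - f y * ∫ y', f y' ^ r ∂ν) ν := J1.sub (I1.mul_const _)
  rw [integral_sub J2 (I2.mul_const _), integral_sub J1 (I1.mul_const _),
    integral_add I3 (integrable_const _), integral_mul_const, integral_mul_const]
  have h0 : 0 ≤ ∫ y, f y ∂ν := (integral_mem_Icc hf hfC).1
  rw [Real.rpow_one_add' h0 (by linarith)]
  simp only [integral_const, probReal_univ, smul_eq_mul, one_mul]
  nlinarith [mul_le_mul_of_nonneg_left jensen h0]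

lemma measurable_integral_right {π : Measure β} [SFinite π] {f : α → β → ℝ}
    (hf : Measurable fun p : α × β => f p.1 p.2) : Measurable fun y => ∫ x, f y x ∂π :=
  (hf.stronglyMeasurable.integral_prod_right').measurable

/-- The inductive step of the tensorization: the one-variable inequality is applied to the partial
average over `x`, and convexity of `gap` brings that average outside. -/
lemma lintegral_rpow_integral_le {r : ℝ} (hr0 : 0 < r) (hr1 : r ≤ 1) {ν : Measure α}
    [IsProbabilityMeasure ν] {π : Measure β} [IsProbabilityMeasure π] {f : α → β → ℝ}
    (hf : Measurable fun p : α × β => f p.1 p.2) {C : ℝ} (hfC : ∀ y x, f y x ∈ Set.Icc 0 C) :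
    ∫⁻ y, ENNReal.ofReal ((∫ x, f y x ∂π) ^ (1 + r)) ∂ν
      ≤ ENNReal.ofReal ((∫ y, ∫ x, f y x ∂π ∂ν) ^ (1 + r))
        + ∫⁻ y, ∫⁻ y', ∫⁻ x, ENNReal.ofReal (gapPos r (f y x) (f y' x)) ∂π ∂ν ∂ν := by
  have hfy : ∀ y, Measurable (f y) := fun y => hf.comp (by fun_prop : Measurable fun x => (y, x))
  set F : α → ℝ := fun y => ∫ x, f y x ∂π with hF
  have mF : Measurable F := measurable_integral_right hf
  have hFC : ∀ y, F y ∈ Set.Icc 0 C := fun y => integral_mem_Icc (hfy y) (hfC y)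
  have mT : Measurable fun p : (α × α) × β =>
      ENNReal.ofReal (gapPos r (f p.1.1 p.2) (f p.1.2 p.2)) := by
    refine (measurable_gapPos (hf.comp (by fun_prop : Measurable fun p : (α × α) × β =>
      (p.1.1, p.2))) (hf.comp (by fun_prop : Measurable fun p : (α × α) × β =>
      (p.1.2, p.2)))).ennreal_ofReal
  have mB : Measurable fun p : α × α =>
      ∫⁻ x, ENNReal.ofReal (gapPos r (f p.1 x) (f p.2 x)) ∂π := mT.lintegral_prod_right'
  set B := ∫⁻ y, ∫⁻ y', ∫⁻ x, ENNReal.ofReal (gapPos r (f y x) (f y' x)) ∂π ∂ν ∂ν with hB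
  have pw : ∀ y y', ENNReal.ofReal (gap r (F y, F y'))
      ≤ ∫⁻ x, ENNReal.ofReal (gapPos r (f y x) (f y' x)) ∂π
        + ∫⁻ x, ENNReal.ofReal (gapPos r (f y' x) (f y x)) ∂π := fun y y' => by
    have mg : Measurable fun x => gap r (f y x, f y' x) :=
      (measurable_gap r).comp ((hfy y).prodMk (hfy y'))
    refine (ENNReal.ofReal_le_ofReal
      (gap_integral_le hr0 hr1 (hfy y) (hfy y') (hfC y) (hfC y'))).trans ?_
    rw [ofReal_integral_eq_lintegral_ofReal
      (integrable_of_mem_Icc mg fun x => gap_mem_Icc hr0 (hfC y x) (hfC y' x))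
      (Filter.Eventually.of_forall fun x => gap_nonneg hr0 (hfC y x).1 (hfC y' x).1),
      ← lintegral_add_left ((measurable_gapPos (hfy y) (hfy y')).ennreal_ofReal)]
    refine (lintegral_congr fun x => ?_).le
    rw [gap_eq_add hr0 (hfC y x).1 (hfC y' x).1,
      ENNReal.ofReal_add (gapPos_nonneg _ _ _) (gapPos_nonneg _ _ _)]
  have hA : ∫⁻ y, ∫⁻ y', ENNReal.ofReal (gap r (F y, F y')) ∂ν ∂ν ≤ B + B := by
    calc _ ≤ ∫⁻ y, ∫⁻ y', (∫⁻ x, ENNReal.ofReal (gapPos r (f y x) (f y' x)) ∂π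
          + ∫⁻ x, ENNReal.ofReal (gapPos r (f y' x) (f y x)) ∂π) ∂ν ∂ν :=
          lintegral_mono fun y => lintegral_mono fun y' => pw y y'
      _ = B + ∫⁻ y, ∫⁻ y', ∫⁻ x, ENNReal.ofReal (gapPos r (f y' x) (f y x)) ∂π ∂ν ∂ν := by
          rw [hB, ← lintegral_add_left mB.lintegral_prod_right']
          exact lintegral_congr fun y =>
            lintegral_add_left (mB.comp (by fun_prop : Measurable fun y' => (y, y'))) _
      -- Exchanging the independent copies `y` and `y'` shows that both halves of `gap` contribute
      -- equally; this cancels the factor 2 of the one-variable inequality.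
      _ = B + B := by
          congr 1
          exact lintegral_lintegral_swap (mB.comp measurable_swap).aemeasurable
  have mG : Measurable fun p : α × α => gap r (F p.1, F p.2) := by fun_prop
  have hA' : ENNReal.ofReal (∫ y, ∫ y', gap r (F y, F y') ∂ν ∂ν)
      = ∫⁻ y, ∫⁻ y', ENNReal.ofReal (gap r (F y, F y')) ∂ν ∂ν := by
    have hI : ∀ y y', gap r (F y, F y') ∈ Set.Icc 0 (C ^ (1 + r) + C ^ (1 + r)) :=
      fun y y' => gap_mem_Icc hr0 (hFC y) (hFC y')
    have mGy : ∀ y, Measurable fun y' => gap r (F y, F y') := fun y => by fun_prop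
    rw [ofReal_integral_eq_lintegral_ofReal (integrable_of_mem_Icc (measurable_integral_right mG)
      fun y => integral_mem_Icc (mGy y) (hI y))
      (Filter.Eventually.of_forall fun y => (integral_mem_Icc (mGy y) (hI y)).1)]
    refine lintegral_congr fun y => ?_
    rw [ofReal_integral_eq_lintegral_ofReal (integrable_of_mem_Icc (mGy y) (hI y))
      (Filter.Eventually.of_forall fun y' => (hI y y').1)]
  have one := ENNReal.ofReal_le_ofReal (integral_rpow_le_add_gap hr0 hr1 (ν := ν) mF hFC)
  have n1 : 0 ≤ ∫ y, F y ∂ν := (integral_mem_Icc mF hFC).1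
  rw [ENNReal.ofReal_add (by positivity)
    (integral_nonneg fun y => integral_nonneg fun y' => gap_nonneg hr0 (hFC y).1 (hFC y').1), hA',
    ENNReal.ofReal_mul two_pos.le, ENNReal.ofReal_mul two_pos.le,
    ofReal_integral_eq_lintegral_ofReal (integrable_of_mem_Icc (by fun_prop)
      fun x => rpow_mem_Icc (by linarith) (hFC x))
    (Filter.Eventually.of_forall fun x => Real.rpow_nonneg (hFC x).1 _)] at one
  have two := one.trans (add_le_add le_rfl hA)
  rw [← two_mul, ENNReal.ofReal_ofNat, ← mul_add] at two
  exact (ENNReal.mul_le_mul_iff_right two_ne_zero ENNReal.ofNat_ne_top).1 two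

lemma measurable_cons {n : ℕ} :
    Measurable fun p : 𝒳 × (Fin n → 𝒳) => (Fin.cons p.1 p.2 : Fin (n + 1) → 𝒳) := by
  refine measurable_pi_iff.2 fun i => ?_
  induction i using Fin.cases with
  | zero => simpa using measurable_fst
  | succ i => simpa [Function.comp_def] using (measurable_pi_apply i).comp measurable_snd

lemma measurePreserving_cons {n : ℕ} (ν : Fin (n + 1) → Measure 𝒳)
    [∀ i, IsProbabilityMeasure (ν i)] :
    MeasurePreserving (fun p : 𝒳 × (Fin n → 𝒳) => (Fin.cons p.1 p.2 : Fin (n + 1) → 𝒳))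
      ((ν 0).prod (Measure.pi fun i => ν i.succ)) (Measure.pi ν) := by
  have h := (measurePreserving_piFinSuccAbove ν 0).symm
  simp only [Fin.succAbove_zero] at h
  convert h using 1
  ext p : 1
  simp [MeasurableEquiv.piFinSuccAbove, Fin.consEquiv]

lemma lintegral_pi_succ {n : ℕ} (ν : Fin (n + 1) → Measure 𝒳)
    [∀ i, IsProbabilityMeasure (ν i)] {g : (Fin (n + 1) → 𝒳) → ℝ≥0∞} (hg : Measurable g) :
    ∫⁻ x, g x ∂Measure.pi ν
      = ∫⁻ y, ∫⁻ x, g (Fin.cons y x) ∂Measure.pi (fun i => ν i.succ) ∂ν 0 := by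
  rw [← (measurePreserving_cons ν).lintegral_comp hg,
    lintegral_prod]
  exact (hg.comp measurable_cons).aemeasurable

/-- Tensorization of the entropy associated with `x ↦ x ^ (1 + r)`, in modified form. -/
theorem lintegral_rpow_pi_le {r : ℝ} (hr0 : 0 < r) (hr1 : r ≤ 1) {n : ℕ}
    (ν : Fin n → Measure 𝒳) [∀ i, IsProbabilityMeasure (ν i)] {f : (Fin n → 𝒳) → ℝ}
    (hf : Measurable f) {C : ℝ} (hfC : ∀ x, f x ∈ Set.Icc 0 C) :
    ∫⁻ x, ENNReal.ofReal (f x ^ (1 + r)) ∂Measure.pi ν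
      ≤ ENNReal.ofReal ((∫ x, f x ∂Measure.pi ν) ^ (1 + r))
        + ∑ i, ∫⁻ x, ∫⁻ z, ENNReal.ofReal (gapPos r (f x) (f (Function.update x i z))) ∂ν i
            ∂Measure.pi ν := by
  induction n with
  | zero => simp [Measure.pi_of_empty ν]
  | succ n ih =>
    have mc : Measurable fun p : 𝒳 × (Fin n → 𝒳) => f (Fin.cons p.1 p.2) :=
      hf.comp measurable_cons
    have mcy : ∀ y, Measurable fun x : Fin n → 𝒳 => f (Fin.cons y x) :=
      fun y => mc.comp (by fun_prop : Measurable fun x => (y, x))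
    have mu : ∀ i, Measurable fun p : (Fin (n + 1) → 𝒳) × 𝒳 =>
        ENNReal.ofReal (gapPos r (f p.1) (f (Function.update p.1 i p.2))) := fun i =>
      (measurable_gapPos (hf.comp measurable_fst)
        (hf.comp measurable_update')).ennreal_ofReal
    have mui : ∀ i, Measurable fun x : Fin (n + 1) → 𝒳 =>
        ∫⁻ z, ENNReal.ofReal (gapPos r (f x) (f (Function.update x i z))) ∂ν i :=
      fun i => (mu i).lintegral_prod_right'
    have muc : ∀ i, Measurable fun p : 𝒳 × (Fin n → 𝒳) =>
        ∫⁻ z, ENNReal.ofReal (gapPos r (f (Fin.cons p.1 p.2))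
          (f (Function.update (Fin.cons p.1 p.2 : Fin (n + 1) → 𝒳) i z))) ∂ν i :=
      fun i => (mui i).comp measurable_cons
    have hint : ∫ x, f x ∂Measure.pi ν
        = ∫ y, ∫ x, f (Fin.cons y x) ∂Measure.pi (fun i => ν i.succ) ∂ν 0 := by
      rw [← (measurePreserving_cons ν).map_eq, integral_map measurable_cons.aemeasurable
        hf.aestronglyMeasurable, integral_prod]
      exact integrable_of_mem_Icc mc fun p => hfC _
    have two := lintegral_rpow_integral_le hr0 hr1 (ν := ν 0)
      (π := Measure.pi fun i => ν i.succ) mc (fun y x => hfC _)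
    rw [lintegral_pi_succ ν (by fun_prop), hint, Fin.sum_univ_succ, ← add_assoc]
    -- The induction hypothesis is used with the first coordinate frozen; `two` then treats the
    -- average over the others as a function of that coordinate.
    have step : ∀ y, _ := fun y => ih (fun i => ν i.succ) (mcy y) (fun x => hfC _)
    refine (lintegral_mono step).trans ?_
    rw [lintegral_add_left ((measurable_integral_right mc).pow_const _).ennreal_ofReal]
    refine add_le_add (two.trans (add_le_add le_rfl ?_)) ?_
    · rw [lintegral_pi_succ ν (mui 0)]
      refine lintegral_mono fun y => ?_
      simp only [Fin.update_cons_zero]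
      rw [lintegral_lintegral_swap]
      exact ((measurable_gapPos (mc.comp (by fun_prop : Measurable fun p : 𝒳 × (Fin n → 𝒳) =>
        (y, p.2))) mc).ennreal_ofReal).aemeasurable
    · rw [lintegral_finsetSum]
      · refine Finset.sum_le_sum fun i _ => ?_
        rw [lintegral_pi_succ ν (mui i.succ)]
        simp only [Fin.cons_update]
        exact le_rfl
      · intro i _
        have := (muc i.succ).lintegral_prod_right' (ν := Measure.pi fun i => ν i.succ)
        simpa only [Fin.cons_update] using this

end Tensorization

/-! ### Conditioning and the moment inequality for functions of independent variables. -/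

/-- Pull-out property of the conditional expectation of a nonnegative function. -/
lemma lintegral_condLExp_mul {Ω : Type*} {m m0 : MeasurableSpace Ω} {μ : Measure Ω}
    [IsProbabilityMeasure μ] (hm : m ≤ m0)
    {f g : Ω → ℝ≥0∞} (hf : Measurable f) (hg : Measurable[m] g) :
    ∫⁻ ω, condLExp m μ f ω * g ω ∂μ = ∫⁻ ω, f ω * g ω ∂μ := by
  have hg' : Measurable g := hg.mono hm le_rfl
  -- The densities `condLExp m μ f` and `f` define the same measure on `m`, and `g` is
  -- `m`-measurable. No finiteness is needed.
  have e : (μ.withDensity (condLExp m μ f)).trim hm = (μ.withDensity f).trim hm := by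
    refine @Measure.ext _ m _ _ fun s hs => ?_
    rw [trim_measurableSet_eq hm hs, trim_measurableSet_eq hm hs, withDensity_apply _ (hm s hs),
      withDensity_apply _ (hm s hs), setLIntegral_condLExp hm μ f hs]
  have h1 := lintegral_withDensity_eq_lintegral_mul μ (measurable_condLExp' m μ f) hg'
  have h2 := lintegral_withDensity_eq_lintegral_mul μ hf hg'
  simp only [Pi.mul_apply] at h1 h2
  rw [← h1, ← h2, ← lintegral_trim hm hg, ← lintegral_trim hm hg, e]

section Probability

variable {Ω 𝒳 : Type*} [MeasurableSpace Ω] [MeasurableSpace 𝒳] {μ : Measure Ω}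
  [IsProbabilityMeasure μ] {n : ℕ} {F : (Fin n → 𝒳) → ℝ} {X X' : Fin n → Ω → 𝒳}

lemma map_eq_pi (hX : ∀ i, Measurable (X i)) (hindep : iIndepFun (Sum.elim X X') μ) :
    μ.map (fun ω j => X j ω) = Measure.pi fun j => μ.map (X j) := by
  have h : iIndepFun X μ := hindep.precomp (g := Sum.inl) Sum.inl_injective
  exact (iIndepFun_iff_map_fun_eq_pi_map fun i => (hX i).aemeasurable).1 h

/-- Each summand of `V⁺` involves the vector `X` and a single copy, so it is this joint law that
links the tensorized terms to `V⁺`. -/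
lemma map_prodMk_eq (hX : ∀ i, Measurable (X i)) (hX' : ∀ i, Measurable (X' i))
    (hindep : iIndepFun (Sum.elim X X') μ) (hcopy : ∀ i, IdentDistrib (X' i) (X i) μ μ)
    (i : Fin n) :
    μ.map (fun ω => (fun j => X j ω, X' i ω))
      = (Measure.pi fun j => μ.map (X j)).prod (μ.map (X i)) := by
  have hm : ∀ k, Measurable (Sum.elim X X' k) := by
    rintro (k | k)
    exacts [hX k, hX' k]
  let S : Finset (Fin n ⊕ Fin n) := Finset.univ.map ⟨Sum.inl, Sum.inl_injective⟩
  let T : Finset (Fin n ⊕ Fin n) := {Sum.inr i}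
  have hST : Disjoint S T := by simp [S, T]
  have h := hindep.indepFun_finset S T hST hm
  have h' : IndepFun (fun ω j => X j ω) (X' i) μ :=
    h.comp (φ := fun (y : S → 𝒳) (j : Fin n) => y ⟨Sum.inl j, by simp [S]⟩)
      (ψ := fun y : T → 𝒳 => y ⟨Sum.inr i, by simp [T]⟩) (by fun_prop) (by fun_prop)
  rw [(indepFun_iff_map_prod_eq_prod_map_map (by fun_prop) (by fun_prop)).1 h',
    map_eq_pi hX hindep, (hcopy i).map_eq]

lemma lintegral_copy (hX : ∀ i, Measurable (X i)) (hX' : ∀ i, Measurable (X' i))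
    (hindep : iIndepFun (Sum.elim X X') μ) (hcopy : ∀ i, IdentDistrib (X' i) (X i) μ μ)
    (i : Fin n) {g : (Fin n → 𝒳) × 𝒳 → ℝ≥0∞} (hg : Measurable g) :
    ∫⁻ x, ∫⁻ z, g (x, z) ∂μ.map (X i) ∂(Measure.pi fun j => μ.map (X j))
      = ∫⁻ ω, g (fun j => X j ω, X' i ω) ∂μ := by
  have := fun j => Measure.isProbabilityMeasure_map (μ := μ) (hX j).aemeasurable
  rw [← lintegral_prod _ hg.aemeasurable, ← map_prodMk_eq hX hX' hindep hcopy i,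
    lintegral_map hg (by fun_prop)]

/-- The exponent `1 / (q - 1)` undoes the power `q - 1`, so one factor is `(a - b)₊`; the
tangent-line bound `rpow_sub_rpow_le` supplies a second one. -/
lemma gapPos_rpow_le {q a b : ℝ} (hq : 2 ≤ q) (ha : 0 ≤ a) (hb : 0 ≤ b) :
    gapPos (1 / (q - 1)) (a ^ (q - 1)) (b ^ (q - 1))
      ≤ (q - 1) * ((max (a - b) 0) ^ 2 * a ^ (q - 2)) := by
  have hq1 : q - 1 ≠ 0 := by linarith
  unfold gapPos
  rw [← Real.rpow_mul ha, ← Real.rpow_mul hb, mul_one_div_cancel hq1, Real.rpow_one,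
    Real.rpow_one]
  rcases le_total a b with h | h
  · simp [max_eq_right (by linarith : a - b ≤ 0)]
  · have h1 := rpow_sub_rpow_le (α := q - 1) (by linarith) hb h
    rw [show q - 1 - 1 = q - 2 by ring] at h1
    have h2 : 0 ≤ (q - 1) * a ^ (q - 2) * (a - b) :=
      mul_nonneg (mul_nonneg (by linarith) (Real.rpow_nonneg ha _)) (by linarith)
    rw [max_eq_left (by linarith : 0 ≤ a - b)]
    calc _ ≤ ((q - 1) * a ^ (q - 2) * (a - b)) * (a - b) :=
          mul_le_mul_of_nonneg_right (max_le h1 h2) (by linarith)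
      _ = _ := by ring

lemma measurable_val (hF : Measurable F) (hX : ∀ i, Measurable (X i)) :
    Measurable (val F X) := hF.comp (measurable_pi_iff.2 hX)

lemma measurable_valCopy (hF : Measurable F) (hX : ∀ i, Measurable (X i))
    (hX' : ∀ i, Measurable (X' i)) (i : Fin n) : Measurable (valCopy F X X' i) :=
  hF.comp (measurable_update'.comp ((measurable_pi_iff.2 hX).prodMk (hX' i)))

/-- The moment inequality obtained from tensorization, for a bounded nonnegative function `G` of the
variables whose positive increments are dominated by those of `F`. -/
lemma lintegral_rpow_le_of_increments (hF : Measurable F)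
    (hX : ∀ i, Measurable (X i)) (hX' : ∀ i, Measurable (X' i))
    (hindep : iIndepFun (Sum.elim X X') μ) (hcopy : ∀ i, IdentDistrib (X' i) (X i) μ μ)
    {G : (Fin n → 𝒳) → ℝ} (hG : Measurable G) {C : ℝ} (hGC : ∀ x, G x ∈ Set.Icc 0 C)
    (hGF : ∀ x y, max (G x - G y) 0 ≤ max (F x - F y) 0) {q : ℝ} (hq : 2 ≤ q) :
    ∫⁻ ω, ENNReal.ofReal (val G X ω ^ q) ∂μ
      ≤ ENNReal.ofReal ((∫ ω, val G X ω ^ (q - 1) ∂μ) ^ (q / (q - 1)))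
        + ENNReal.ofReal (q - 1)
          * ∫⁻ ω, Vplus μ F X X' ω * ENNReal.ofReal (val G X ω ^ (q - 2)) ∂μ := by
  have := fun j => Measure.isProbabilityMeasure_map (μ := μ) (hX j).aemeasurable
  have hq1 : 0 < q - 1 := by linarith
  have hr : 1 + 1 / (q - 1) = q / (q - 1) := by field_simp; ring
  have mX : Measurable fun ω j => X j ω := measurable_pi_iff.2 hX
  have hm : sigmaX X ≤ ‹MeasurableSpace Ω› := mX.comap_le
  have mV := measurable_val hF hX
  have mV' := measurable_valCopy hF hX hX'
  have mG := measurable_val hG hX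
  have h := lintegral_rpow_pi_le (r := 1 / (q - 1)) (by positivity)
    (by rw [div_le_one hq1]; linarith) (fun j => μ.map (X j)) (f := fun x => G x ^ (q - 1))
    (by fun_prop) (fun x => rpow_mem_Icc hq1.le (hGC x))
  rw [hr, ← map_eq_pi hX hindep, lintegral_map (by fun_prop) mX,
    integral_map mX.aemeasurable (hG.pow_const _).aestronglyMeasurable, map_eq_pi hX hindep] at h
  have e1 : ∀ ω, (G (fun j => X j ω) ^ (q - 1)) ^ (q / (q - 1)) = val G X ω ^ q := fun ω => by
    rw [← Real.rpow_mul (hGC _).1, mul_div_cancel₀ _ hq1.ne']; rfl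
  simp only [e1] at h
  refine h.trans (add_le_add le_rfl ?_)
  have mD : Measurable fun ω =>
      ∑ i, ENNReal.ofReal ((max (val F X ω - valCopy F X X' i ω) 0) ^ 2) :=
    Finset.measurable_sum _ fun i _ => by have := mV' i; fun_prop
  have mg : Measurable[sigmaX X] fun ω => ENNReal.ofReal (val G X ω ^ (q - 2)) :=
    (show Measurable fun x => ENNReal.ofReal (G x ^ (q - 2)) by fun_prop).comp
      (comap_measurable fun ω j => X j ω)
  rw [Vplus, lintegral_condLExp_mul hm mD mg]
  simp_rw [Finset.sum_mul]
  rw [lintegral_finsetSum _ fun i _ => by have := mV' i; fun_prop, Finset.mul_sum]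
  refine Finset.sum_le_sum fun i _ => ?_
  have hgm : Measurable fun p : (Fin n → 𝒳) × 𝒳 => ENNReal.ofReal (gapPos (1 / (q - 1))
      (G p.1 ^ (q - 1)) (G (Function.update p.1 i p.2) ^ (q - 1))) :=
    (measurable_gapPos ((hG.comp measurable_fst).pow_const _)
      ((hG.comp measurable_update').pow_const _)).ennreal_ofReal
  rw [lintegral_copy hX hX' hindep hcopy i hgm,
    ← lintegral_const_mul _ (by have := mV' i; fun_prop)]
  refine lintegral_mono fun ω => ?_
  dsimp only
  rw [← ENNReal.ofReal_mul (by positivity), ← ENNReal.ofReal_mul hq1.le]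
  refine ENNReal.ofReal_le_ofReal ((gapPos_rpow_le hq (hGC _).1 (hGC _).1).trans ?_)
  have h0 : 0 ≤ G (fun j => X j ω) ^ (q - 2) := Real.rpow_nonneg (hGC _).1 _
  refine mul_le_mul_of_nonneg_left (mul_le_mul_of_nonneg_right ?_ h0) hq1.le
  exact pow_le_pow_left₀ (le_max_right _ _) (hGF _ _) 2

end Probability

/-! ### Norms, Efron–Stein and the bounded case. -/

section Probability

variable {Ω 𝒳 : Type*} [MeasurableSpace Ω] [MeasurableSpace 𝒳] {μ : Measure Ω}
  {n : ℕ} {F : (Fin n → 𝒳) → ℝ} {X X' : Fin n → Ω → 𝒳}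

lemma eLpNorm_ennreal_eq {s : ℝ} (hs : 0 < s) (V : Ω → ℝ≥0∞) :
    eLpNorm V (ENNReal.ofReal s) μ = (∫⁻ ω, V ω ^ s ∂μ) ^ (1 / s) := by
  rw [eLpNorm_eq_lintegral_rpow_enorm_toReal (by simpa using hs) ENNReal.ofReal_ne_top,
    ENNReal.toReal_ofReal hs.le]
  simp

lemma eLpNorm_bounded_eq [IsProbabilityMeasure μ] {g : Ω → ℝ} (hg : Measurable g) {C : ℝ}
    (hgC : ∀ ω, g ω ∈ Set.Icc 0 C) {s : ℝ} (hs : 0 < s) :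
    eLpNorm g (ENNReal.ofReal s) μ = ENNReal.ofReal ((∫ ω, g ω ^ s ∂μ) ^ (1 / s)) := by
  have hp : ∀ ω, g ω ^ s ∈ Set.Icc 0 (C ^ s) := fun ω => rpow_mem_Icc hs.le (hgC ω)
  have mp : Measurable fun ω => g ω ^ s := hg.pow_const _
  rw [eLpNorm_eq_lintegral_rpow_enorm_toReal (by simpa using hs) ENNReal.ofReal_ne_top,
    ENNReal.toReal_ofReal hs.le, ← ENNReal.ofReal_rpow_of_nonneg (integral_mem_Icc mp hp).1
      (by positivity), ofReal_integral_eq_lintegral_ofReal (integrable_of_mem_Icc mp hp)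
      (Filter.Eventually.of_forall fun ω => (hp ω).1)]
  congr 1
  refine lintegral_congr fun ω => ?_
  rw [Real.enorm_of_nonneg (hgC ω).1, ENNReal.ofReal_rpow_of_nonneg (hgC ω).1 hs.le]

/-- Hölder with exponents `s / 2` and `s / (s - 2)`; at `s = 2` the second is infinite, but then the
power of `g` is the constant 1. -/
lemma lintegral_mul_rpow_le [IsProbabilityMeasure μ] {V : Ω → ℝ≥0∞} (hV : Measurable V)
    {g : Ω → ℝ} (hg : Measurable g) {C : ℝ} (hgC : ∀ ω, g ω ∈ Set.Icc 0 C) {s : ℝ} (hs : 2 ≤ s) :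
    ∫⁻ ω, V ω * ENNReal.ofReal (g ω ^ (s - 2)) ∂μ
      ≤ eLpNorm V (ENNReal.ofReal (s / 2)) μ
        * ENNReal.ofReal ((eLpNorm g (ENNReal.ofReal s) μ).toReal ^ (s - 2)) := by
  have hs0 : 0 < s := by linarith
  have hp : ∀ ω, g ω ^ s ∈ Set.Icc 0 (C ^ s) := fun ω => rpow_mem_Icc hs0.le (hgC ω)
  have mp : Measurable fun ω => g ω ^ s := hg.pow_const _
  have hI := (integral_mem_Icc (μ := μ) mp hp).1
  rw [eLpNorm_ennreal_eq (by linarith), eLpNorm_bounded_eq hg hgC hs0,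
    ENNReal.toReal_ofReal (by positivity), ← Real.rpow_mul hI]
  rcases eq_or_lt_of_le hs with rfl | hs2
  · simp
  have hs2' : 0 < s - 2 := by linarith
  have conj : (s / 2).HolderConjugate (s / (s - 2)) := by
    rw [Real.holderConjugate_iff]
    exact ⟨by linarith, by field_simp; ring⟩
  refine (ENNReal.lintegral_mul_le_Lp_mul_Lq μ conj (g := fun ω => ENNReal.ofReal
    (g ω ^ (s - 2))) hV.aemeasurable (by fun_prop)).trans (le_of_eq ?_)
  congr 1
  rw [← ENNReal.ofReal_rpow_of_nonneg hI (by positivity),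
    ofReal_integral_eq_lintegral_ofReal (integrable_of_mem_Icc mp hp)
      (Filter.Eventually.of_forall fun ω => (hp ω).1)]
  congr 1
  · refine lintegral_congr fun ω => ?_
    rw [ENNReal.ofReal_rpow_of_nonneg (Real.rpow_nonneg (hgC ω).1 _) (by positivity),
      ← Real.rpow_mul (hgC ω).1, mul_div_cancel₀ _ hs2'.ne']
  · field_simp

lemma measurable_Vplus (μ : Measure Ω) (F : (Fin n → 𝒳) → ℝ) (X X' : Fin n → Ω → 𝒳) :
    Measurable (Vplus μ F X X') := measurable_condLExp' _ _ _

lemma rpow_half_mul_le {q : ℝ} (hq : 2 ≤ q) (A : ℝ≥0∞) :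
    (ENNReal.ofReal ((1 - 1 / q) * (2 * kappa q * q)) * A) ^ (1 / 2 : ℝ)
      ≤ (ENNReal.ofReal (2 * kappa q * q) * A) ^ (1 / 2 : ℝ) := by
  have := two_le_two_kappa hq
  have h0 : 0 ≤ 2 * kappa q * q := mul_nonneg (by linarith) (by linarith)
  have h1 : 0 ≤ 1 / q := by positivity
  exact ENNReal.rpow_le_rpow (mul_le_mul_left (ENNReal.ofReal_le_ofReal
    (mul_le_of_le_one_left h0 (sub_le_self 1 h1))) A) (by norm_num)

lemma rpow_half_mul_eq {q c : ℝ} (hq : 0 < q) (hc : 0 ≤ c) (V : Ω → ℝ≥0∞) :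
    (ENNReal.ofReal c * eLpNorm V (ENNReal.ofReal (q / 2)) μ) ^ (1 / 2 : ℝ)
      = ENNReal.ofReal (Real.sqrt c)
        * eLpNorm (fun ω => V ω ^ (1 / 2 : ℝ)) (ENNReal.ofReal q) μ := by
  rw [ENNReal.mul_rpow_of_nonneg _ _ (by norm_num), ENNReal.ofReal_rpow_of_nonneg hc (by norm_num),
    ← Real.sqrt_eq_rpow, eLpNorm_ennreal_eq (by linarith), eLpNorm_ennreal_eq hq,
    ← ENNReal.rpow_mul]
  simp_rw [← ENNReal.rpow_mul]
  congr 2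
  · refine lintegral_congr fun ω => ?_
    congr 1; ring
  · field_simp

lemma Vminus_eq_Vplus_neg (F : (Fin n → 𝒳) → ℝ) (X X' : Fin n → Ω → 𝒳) :
    Vminus μ F X X' = Vplus μ (fun x => -F x) X X' := by
  unfold Vminus Vplus val valCopy
  congr 1
  ext ω
  simp only [neg_sub, sub_neg_eq_add, neg_add_eq_sub]

variable [IsProbabilityMeasure μ]

/-- The Efron–Stein inequality, for a bounded function `G` of the variables whose positive
increments are dominated by those of `F`. -/
lemma variance_le_lintegral_Vplus (hF : Measurable F)
    (hX : ∀ i, Measurable (X i)) (hX' : ∀ i, Measurable (X' i))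
    (hindep : iIndepFun (Sum.elim X X') μ) (hcopy : ∀ i, IdentDistrib (X' i) (X i) μ μ)
    {G : (Fin n → 𝒳) → ℝ} (hG : Measurable G) {M : ℝ} (hGM : ∀ x, G x ∈ Set.Icc (-M) M)
    (hGF : ∀ x y, max (G x - G y) 0 ≤ max (F x - F y) 0) :
    ENNReal.ofReal (∫ ω, (val G X ω - ∫ ω', val G X ω' ∂μ) ^ 2 ∂μ)
      ≤ ∫⁻ ω, Vplus μ F X X' ω ∂μ := by
  have mZ := measurable_val hG hX
  have hH : ∀ x, G x + M ∈ Set.Icc 0 (M + M) := fun x =>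
    ⟨by linarith [(hGM x).1], by linarith [(hGM x).2]⟩
  -- The shift by `M` makes the function nonnegative without changing increments or variance. At `q
  -- = 2` the weight multiplying `V⁺` is 1.
  have h := lintegral_rpow_le_of_increments hF hX hX' hindep hcopy (G := fun x => G x + M)
    (by fun_prop) hH (fun x y => by simpa using hGF x y) le_rfl
  have e : ∀ ω, val (fun x => G x + M) X ω = val G X ω + M := fun ω => rfl
  have n2 : (2 : ℝ) - 1 = 1 := by norm_num
  simp only [e, sub_self, Real.rpow_zero, ENNReal.ofReal_one, mul_one, n2, Real.rpow_one,
    div_one, one_mul, Real.rpow_two] at h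
  have I1 : Integrable (val G X) μ := integrable_of_mem_Icc mZ fun ω => hGM _
  have I2 : Integrable (fun ω => val G X ω ^ 2) μ :=
    integrable_of_mem_Icc (a := 0) (b := M ^ 2) (by fun_prop) fun ω =>
      ⟨sq_nonneg _, sq_le_sq' (hGM _).1 (hGM _).2⟩
  have sq : ∀ c : ℝ, ∫ ω, (val G X ω + c) ^ 2 ∂μ
      = ∫ ω, val G X ω ^ 2 ∂μ + 2 * c * ∫ ω, val G X ω ∂μ + c ^ 2 := fun c => by
    have : ∀ ω, (val G X ω + c) ^ 2 = val G X ω ^ 2 + (2 * c) * val G X ω + c ^ 2 :=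
      fun ω => by ring
    have J : Integrable (fun ω => val G X ω ^ 2 + (2 * c) * val G X ω) μ :=
      I2.add (I1.const_mul _)
    simp_rw [this]
    rw [integral_add J (integrable_const _), integral_add I2 (I1.const_mul _),
      integral_const_mul]
    simp
  rw [← ofReal_integral_eq_lintegral_ofReal
    (f := fun ω => (val G X ω + M) ^ 2)
    (integrable_of_mem_Icc (a := 0) (b := (M + M) ^ 2) (by fun_prop) fun ω =>
      ⟨sq_nonneg _, pow_le_pow_left₀ (hH _).1 (hH _).2 2⟩)
    (Filter.Eventually.of_forall fun ω => sq_nonneg _), sq,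
    integral_add I1 (integrable_const _)] at h
  have s2 := sq (-∫ ω', val G X ω' ∂μ)
  simp only [← sub_eq_add_neg] at s2
  rw [s2]
  simp only [integral_const, probReal_univ, smul_eq_mul, one_mul] at h
  rw [show ∫ ω, val G X ω ^ 2 ∂μ + 2 * M * ∫ ω, val G X ω ∂μ + M ^ 2
      = (∫ ω, val G X ω ^ 2 ∂μ + 2 * (-∫ ω, val G X ω ∂μ) * ∫ ω, val G X ω ∂μ
        + (-∫ ω, val G X ω ∂μ) ^ 2) + (∫ ω, val G X ω ∂μ + M) ^ 2 by ring,
    ENNReal.ofReal_add (by rw [← s2]; exact integral_nonneg fun ω => sq_nonneg _)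
      (sq_nonneg _), add_comm] at h
  exact (ENNReal.add_le_add_iff_left ENNReal.ofReal_ne_top).1 h

/-- Allows `(G - m)₊` to inherit the increment bound of `G`. -/
lemma max_sub_max_le (a b c : ℝ) :
    max (max (a - c) 0 - max (b - c) 0) 0 ≤ max (a - b) 0 := by
  simp only [max_def]
  split_ifs <;> linarith

/-- The moment inequality for a bounded function `G` of the variables whose positive increments are
dominated by those of `F`. -/
lemma eLpNorm_le_of_bounded (hF : Measurable F)
    (hX : ∀ i, Measurable (X i)) (hX' : ∀ i, Measurable (X' i))
    (hindep : iIndepFun (Sum.elim X X') μ) (hcopy : ∀ i, IdentDistrib (X' i) (X i) μ μ)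
    {G : (Fin n → 𝒳) → ℝ} (hG : Measurable G) {M : ℝ} (hGM : ∀ x, G x ∈ Set.Icc (-M) M)
    (hGF : ∀ x y, max (G x - G y) 0 ≤ max (F x - F y) 0) {q : ℝ} (hq : 2 ≤ q)
    (hV : eLpNorm (Vplus μ F X X') (ENNReal.ofReal (q / 2)) μ ≠ ∞) :
    eLpNorm (fun ω => max (val G X ω - ∫ ω', val G X ω' ∂μ) 0) (ENNReal.ofReal q) μ
      ≤ (ENNReal.ofReal ((1 - 1 / q) * (2 * kappa q * q))
          * eLpNorm (Vplus μ F X X') (ENNReal.ofReal (q / 2)) μ) ^ (1 / 2 : ℝ) := by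
  set m := ∫ ω', val G X ω' ∂μ with hm
  set V := Vplus μ F X X' with hVdef
  have mV : Measurable V := measurable_Vplus μ F X X'
  set v := (eLpNorm V (ENNReal.ofReal (q / 2)) μ).toReal with hv
  have hv0 : 0 ≤ v := ENNReal.toReal_nonneg
  have hVv : ∀ s, 2 ≤ s → s ≤ q → eLpNorm V (ENNReal.ofReal (s / 2)) μ ≤ ENNReal.ofReal v :=
    fun s _ hsq => by
      rw [hv, ENNReal.ofReal_toReal hV]
      exact eLpNorm_le_eLpNorm_of_exponent_le (ENNReal.ofReal_le_ofReal (by linarith))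
        mV.aestronglyMeasurable
  have mZ := measurable_val hG hX
  have hmM : m ∈ Set.Icc (-M) M := integral_mem_Icc mZ fun ω => hGM _
  let H : (Fin n → 𝒳) → ℝ := fun x => max (G x - m) 0
  have mH : Measurable H := by fun_prop
  have hH : ∀ x, H x ∈ Set.Icc 0 (M + M) := fun x =>
    ⟨le_max_right _ _, max_le (by linarith [(hGM x).2, hmM.1]) (by linarith [hmM.1, hmM.2])⟩
  have mg : Measurable (val H X) := measurable_val mH hX
  have hg : ∀ ω, val H X ω ∈ Set.Icc 0 (M + M) := fun ω => hH _
  change eLpNorm (val H X) _ μ ≤ _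
  set N : ℝ → ℝ := fun s => (eLpNorm (val H X) (ENNReal.ofReal s) μ).toReal with hN
  have hN_eq : ∀ s, 0 < s → N s = (∫ ω, val H X ω ^ s ∂μ) ^ (1 / s) := fun s hs => by
    have := (integral_mem_Icc (μ := μ) (mg.pow_const s) fun ω => rpow_mem_Icc hs.le (hg ω)).1
    simp only [hN]
    rw [eLpNorm_bounded_eq mg hg hs, ENNReal.toReal_ofReal (by positivity)]
  have hN_top : ∀ s, 0 < s → eLpNorm (val H X) (ENNReal.ofReal s) μ ≠ ∞ := fun s hs => by
    rw [eLpNorm_bounded_eq mg hg hs]; exact ENNReal.ofReal_ne_top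
  have hN0 : ∀ s, 0 ≤ N s := fun s => ENNReal.toReal_nonneg
  -- Efron–Stein is applied to `G`, not to its positive part: `(G - m)₊ ^ 2 ≤ (G - m) ^ 2`, and the
  -- latter integrates to the variance.
  have hN2 : N 2 ^ 2 ≤ v := by
    have hvar : ∫ ω, (val G X ω - m) ^ 2 ∂μ ≤ v := by
      refine (ENNReal.ofReal_le_ofReal_iff hv0).1
        ((variance_le_lintegral_Vplus hF hX hX' hindep hcopy hG hGM hGF).trans ?_)
      have := hVv 2 le_rfl hq
      rw [eLpNorm_ennreal_eq (by norm_num)] at this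
      simpa using this
    have hle : ∫ ω, val H X ω ^ (2 : ℝ) ∂μ ≤ ∫ ω, (val G X ω - m) ^ 2 ∂μ := by
      refine integral_mono (integrable_of_mem_Icc (by fun_prop) fun ω =>
        rpow_mem_Icc two_pos.le (hg ω)) (integrable_of_mem_Icc (a := 0) (b := (M + M) ^ 2)
        (by fun_prop) fun ω => ⟨sq_nonneg _, ?_⟩) fun ω => ?_
      · have h : G (fun j => X j ω) ∈ Set.Icc (-M) M := hGM _
        exact sq_le_sq' (by simp only [val]; linarith [h.1, hmM.2])
          (by simp only [val]; linarith [h.2, hmM.1])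
      · change max (val G X ω - m) 0 ^ (2 : ℝ) ≤ _
        rw [Real.rpow_two]
        rcases le_total (val G X ω - m) 0 with h | h
        · rw [max_eq_right h, zero_pow two_ne_zero]; exact sq_nonneg _
        · rw [max_eq_left h]
    have h0 := (integral_mem_Icc (μ := μ) (mg.pow_const 2)
      fun ω => rpow_mem_Icc two_pos.le (hg ω)).1
    rw [hN_eq 2 two_pos, ← Real.sqrt_eq_rpow, Real.sq_sqrt h0]
    exact hle.trans hvar
  have key : N q ^ 2 ≤ (q - 1) * (2 * kappa q) * v := by
    refine moment_recursion hv0 hN0 (fun s hs1 hs2 => ?_) (fun s hs2 hsq => ?_) hq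
    · refine le_trans (pow_le_pow_left₀ (hN0 s) ?_ 2) hN2
      exact ENNReal.toReal_mono (hN_top 2 two_pos) (eLpNorm_le_eLpNorm_of_exponent_le
        (ENNReal.ofReal_le_ofReal hs2) mg.aestronglyMeasurable)
    · have hs0 : 0 < s := by linarith
      have hs1 : 0 < s - 1 := by linarith
      have hI := (integral_mem_Icc (μ := μ) (mg.pow_const s)
        fun ω => rpow_mem_Icc hs0.le (hg ω)).1
      have hI' := (integral_mem_Icc (μ := μ) (mg.pow_const (s - 1))
        fun ω => rpow_mem_Icc hs1.le (hg ω)).1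
      have e1 : N s ^ s = ∫ ω, val H X ω ^ s ∂μ := by
        rw [hN_eq s hs0, ← Real.rpow_mul hI, one_div_mul_cancel hs0.ne', Real.rpow_one]
      have e2 : N (s - 1) ^ s = (∫ ω, val H X ω ^ (s - 1) ∂μ) ^ (s / (s - 1)) := by
        rw [hN_eq _ hs1, ← Real.rpow_mul hI', one_div_mul_eq_div]
      have h := lintegral_rpow_le_of_increments hF hX hX' hindep hcopy mH hH
        (fun x y => (max_sub_max_le (G x) (G y) m).trans (hGF x y)) hs2
      have hold := (lintegral_mul_rpow_le mV mg hg hs2).trans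
        (mul_le_mul_left (hVv s hs2 hsq) _)
      rw [← e2, ← ofReal_integral_eq_lintegral_ofReal (integrable_of_mem_Icc (mg.pow_const s)
        fun ω => rpow_mem_Icc hs0.le (hg ω))
        (Filter.Eventually.of_forall fun ω => Real.rpow_nonneg (hg ω).1 _), ← e1] at h
      have h' := h.trans (add_le_add le_rfl (mul_le_mul_right hold _))
      have hNs : 0 ≤ N s ^ (s - 2) := Real.rpow_nonneg (hN0 _) _
      have hNs' : 0 ≤ N (s - 1) ^ s := Real.rpow_nonneg (hN0 _) _
      rw [← ENNReal.ofReal_mul hv0, ← ENNReal.ofReal_mul hs1.le,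
        ← ENNReal.ofReal_add hNs' (by positivity), ENNReal.ofReal_le_ofReal_iff (by positivity),
        ← mul_assoc] at h'
      exact h'
  have hc : (1 - 1 / q) * (2 * kappa q * q) = (q - 1) * (2 * kappa q) := by
    have : q ≠ 0 := by linarith
    field_simp
  have hk := two_le_two_kappa hq
  have hc0 : 0 ≤ (q - 1) * (2 * kappa q) := mul_nonneg (by linarith) (by linarith)
  rw [hc, ← ENNReal.ofReal_toReal hV, ← hv, ← ENNReal.ofReal_mul hc0,
    ENNReal.ofReal_rpow_of_nonneg (by positivity) (by norm_num), ← Real.sqrt_eq_rpow,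
    ← ENNReal.ofReal_toReal (hN_top q (by linarith))]
  exact ENNReal.ofReal_le_ofReal (Real.le_sqrt_of_sq_le key)

/-! ### Removing boundedness by truncation. -/

/-- Truncation at levels `-M` and `M`. -/
def clamp (M a : ℝ) : ℝ := max (min a M) (-M)

lemma clamp_mem {M : ℝ} (hM : 0 ≤ M) (a : ℝ) : clamp M a ∈ Set.Icc (-M) M :=
  ⟨le_max_right _ _, max_le (min_le_right _ _) (by linarith)⟩

lemma clamp_sub_le (M a b : ℝ) : max (clamp M a - clamp M b) 0 ≤ max (a - b) 0 := by
  unfold clamp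
  simp only [max_def, min_def]
  split_ifs <;> linarith

lemma clamp_eq {M a : ℝ} (h : |a| ≤ M) : clamp M a = a := by
  have := abs_le.1 h
  rw [clamp, min_eq_left this.2, max_eq_left this.1]

lemma abs_clamp_le {M : ℝ} (hM : 0 ≤ M) (a : ℝ) : |clamp M a| ≤ |a| := by
  rcases le_total |a| M with h | h
  · rw [clamp_eq h]
  · exact (abs_le.2 (clamp_mem hM a)).trans h

open Filter Topology in
lemma tendsto_clamp (a : ℝ) : Tendsto (fun k : ℕ => clamp k a) atTop (𝓝 a) := by
  obtain ⟨k, hk⟩ := exists_nat_ge |a|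
  refine tendsto_const_nhds.congr' ?_
  filter_upwards [eventually_ge_atTop k] with j hj
  exact (clamp_eq (hk.trans (by exact_mod_cast hj))).symm

open Filter Topology in
-- Clamping does not enlarge positive increments, so every truncation obeys the bounded bound with
-- the same `V⁺`, that of `F`. The truncated means converge by domination and the norms pass to the
-- limit by Fatou.
theorem eLpNorm_posPart_le (hF : Measurable F)
    (hX : ∀ i, Measurable (X i)) (hX' : ∀ i, Measurable (X' i))
    (hindep : iIndepFun (Sum.elim X X') μ) (hcopy : ∀ i, IdentDistrib (X' i) (X i) μ μ)
    (hZ : Integrable (val F X) μ) {q : ℝ} (hq : 2 ≤ q) :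
    eLpNorm (fun ω => max (val F X ω - ∫ ω', val F X ω' ∂μ) 0) (ENNReal.ofReal q) μ
      ≤ (ENNReal.ofReal ((1 - 1 / q) * (2 * kappa q * q))
          * eLpNorm (Vplus μ F X X') (ENNReal.ofReal (q / 2)) μ) ^ (1 / 2 : ℝ) := by
  by_cases hV : eLpNorm (Vplus μ F X X') (ENNReal.ofReal (q / 2)) μ = ∞
  · have hc : 0 < (1 - 1 / q) * (2 * kappa q * q) := by
      have : 1 / q < 1 := by rw [div_lt_one (by linarith)]; linarith
      have := two_le_two_kappa hq
      exact mul_pos (by linarith) (mul_pos (by linarith) (by linarith))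
    rw [hV, ENNReal.mul_top (by simpa using hc), ENNReal.top_rpow_of_pos (by norm_num)]
    exact le_top
  let G : ℕ → (Fin n → 𝒳) → ℝ := fun k x => clamp k (F x)
  have mG : ∀ k, Measurable (G k) := fun k => by
    simp only [G, clamp]; fun_prop
  have mZ := fun k => measurable_val (mG k) hX
  have hint : Tendsto (fun k => ∫ ω, val (G k) X ω ∂μ) atTop (𝓝 (∫ ω, val F X ω ∂μ)) :=
    tendsto_integral_of_dominated_convergence (fun ω => |val F X ω|)
      (fun k => (mZ k).aestronglyMeasurable) hZ.abs
      (fun k => Eventually.of_forall fun ω => abs_clamp_le (Nat.cast_nonneg k) _)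
      (Eventually.of_forall fun ω => tendsto_clamp _)
  refine (Lp.eLpNorm_lim_le_liminf_eLpNorm
    (f := fun k ω => max (val (G k) X ω - ∫ ω', val (G k) X ω' ∂μ) 0)
    (fun k => by have := mZ k; exact Measurable.aestronglyMeasurable (by fun_prop)) _
    (Eventually.of_forall fun ω => ((tendsto_clamp _).sub hint).max tendsto_const_nhds)).trans ?_
  refine (liminf_le_liminf (Eventually.of_forall fun k => eLpNorm_le_of_bounded hF hX hX' hindep
    hcopy (mG k) (fun x => clamp_mem (Nat.cast_nonneg k) _) (fun x y => clamp_sub_le _ _ _) hq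
    hV)).trans (liminf_const _).le

end Probability

end MomentIneq

theorem theorem2 {Ω 𝒳 : Type*} [MeasurableSpace Ω] [MeasurableSpace 𝒳]
    (μ : Measure Ω) [IsProbabilityMeasure μ] (n : ℕ)
    (F : (Fin n → 𝒳) → ℝ) (hF : Measurable F)
    (X X' : Fin n → Ω → 𝒳)
    (hX : ∀ i, Measurable (X i)) (hX' : ∀ i, Measurable (X' i))
    -- `X₁, …, Xₙ, X'₁, …, X'ₙ` are independent, and `X'ᵢ` has the law of `Xᵢ`
    (hindep : iIndepFun (Sum.elim X X') μ)
    (hcopy : ∀ i, IdentDistrib (X' i) (X i) μ μ)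
    (hZ : Integrable (MomentIneq.val F X) μ)
    (q : ℝ) (hq : 2 ≤ q) :
    (eLpNorm (fun ω => max (MomentIneq.val F X ω - ∫ ω', MomentIneq.val F X ω' ∂μ) 0)
          (ENNReal.ofReal q) μ
        ≤ (ENNReal.ofReal ((1 - 1 / q) * (2 * MomentIneq.kappa q * q))
            * eLpNorm (MomentIneq.Vplus μ F X X') (ENNReal.ofReal (q / 2)) μ) ^ (1 / 2 : ℝ)
      ∧ (ENNReal.ofReal ((1 - 1 / q) * (2 * MomentIneq.kappa q * q))
            * eLpNorm (MomentIneq.Vplus μ F X X') (ENNReal.ofReal (q / 2)) μ) ^ (1 / 2 : ℝ)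
        ≤ (ENNReal.ofReal (2 * MomentIneq.kappa q * q)
            * eLpNorm (MomentIneq.Vplus μ F X X') (ENNReal.ofReal (q / 2)) μ) ^ (1 / 2 : ℝ)
      ∧ (ENNReal.ofReal (2 * MomentIneq.kappa q * q)
            * eLpNorm (MomentIneq.Vplus μ F X X') (ENNReal.ofReal (q / 2)) μ) ^ (1 / 2 : ℝ)
        = ENNReal.ofReal (Real.sqrt (2 * MomentIneq.kappa q * q))
            * eLpNorm (fun ω => MomentIneq.Vplus μ F X X' ω ^ (1 / 2 : ℝ)) (ENNReal.ofReal q) μ)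
    ∧
    (eLpNorm (fun ω => max (-(MomentIneq.val F X ω - ∫ ω', MomentIneq.val F X ω' ∂μ)) 0)
          (ENNReal.ofReal q) μ
        ≤ (ENNReal.ofReal ((1 - 1 / q) * (2 * MomentIneq.kappa q * q))
            * eLpNorm (MomentIneq.Vminus μ F X X') (ENNReal.ofReal (q / 2)) μ) ^ (1 / 2 : ℝ)
      ∧ (ENNReal.ofReal ((1 - 1 / q) * (2 * MomentIneq.kappa q * q))
            * eLpNorm (MomentIneq.Vminus μ F X X') (ENNReal.ofReal (q / 2)) μ) ^ (1 / 2 : ℝ)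
        ≤ (ENNReal.ofReal (2 * MomentIneq.kappa q * q)
            * eLpNorm (MomentIneq.Vminus μ F X X') (ENNReal.ofReal (q / 2)) μ) ^ (1 / 2 : ℝ)
      ∧ (ENNReal.ofReal (2 * MomentIneq.kappa q * q)
            * eLpNorm (MomentIneq.Vminus μ F X X') (ENNReal.ofReal (q / 2)) μ) ^ (1 / 2 : ℝ)
        = ENNReal.ofReal (Real.sqrt (2 * MomentIneq.kappa q * q))
            * eLpNorm (fun ω => MomentIneq.Vminus μ F X X' ω ^ (1 / 2 : ℝ))
                (ENNReal.ofReal q) μ) := by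
  have hk := MomentIneq.two_le_two_kappa hq
  have hc : 0 ≤ 2 * MomentIneq.kappa q * q := mul_nonneg (by linarith) (by linarith)
  refine ⟨⟨MomentIneq.eLpNorm_posPart_le hF hX hX' hindep hcopy hZ hq,
    MomentIneq.rpow_half_mul_le hq _, MomentIneq.rpow_half_mul_eq (by linarith) hc _⟩,
    ?_, MomentIneq.rpow_half_mul_le hq _, MomentIneq.rpow_half_mul_eq (by linarith) hc _⟩
  -- The lower tail is the upper tail of `-F`, whose `V⁺` is the `V⁻` of `F`.
  have h := MomentIneq.eLpNorm_posPart_le (F := fun x => -F x) hF.neg hX hX' hindep hcopy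
    hZ.neg hq
  rw [← MomentIneq.Vminus_eq_Vplus_neg] at h
  have e : ∀ ω, MomentIneq.val (fun x => -F x) X ω = -MomentIneq.val F X ω := fun ω => rfl
  simp only [e, integral_neg, sub_neg_eq_add] at h
  simpa only [neg_sub, neg_add_eq_sub] using h
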